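/- For an integer matrix $E$ with $n$ columns, let $\mathcal G(E)$ denote its Graver basis: the set of all nonzero $v\in\ker(E)\cap\mathbb Z^n$ that cannot be written as $v=v'+v''$ with nonzero $v',v''\in\ker(E)\cap\mathbb Z^n$ lying in a common orthant with $v$. The set $\mathcal G(E)$ is finite; put $\gamma(E):=\max\{\|v\|_1 : v\in\mathcal G(E)\}$, with $\gamma(E):=0$ if $\mathcal G(E)=\emptyset$. Let $A\in\mathbb Z^{d_A\times n_A}$, $B\in\mathbb Z^{d_A\times n_B}$, $C\in\mathbb Z^{d_C\times n_B}$, $D\in\mathbb Z^{d_C\times n_A}$, and for $N\in\mathbb Z_{\ge 0}$ let $$E_N:=\begin{pmatrix} C & D & D & \cdots & D\\ B & A & 0 & \cdots & 0\\ B & 0 & A & & 0\\ \vdots & \vdots & & \ddots & \\ B & 0 & 0 & & A\end{pmatrix},\qquad L_N:=\begin{pmatrix} B & A & 0 & \cdots & 0\\ B & 0 & A & & 0\\ \vdots & \vdots & & \ddots & \\ B & 0 & 0 & & A\end{pmatrix}$$ with $N$ copies of $A$ (so $L_N$ is $E_N$ without its first block row). There is a number $g\in\mathbb Z_{\ge 0}$,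 depending only on $A$ and $B$ and not on $N$, such that $\|v\|_\infty\le g$ for every $N\in\mathbb Z_{\ge 0}$ and every $v\in\mathcal G(L_N)$. For every such $g$, every real $M\ge 1$ that bounds the absolute values of all entries of $C$ and $D$, and every $N\in\mathbb Z_{\ge 0}$, $$\gamma(E_N)\;\le\;\bigl(2(n_B+Nn_A)M\bigr)^{2^{d_C}-1}\,\gamma(L_N)^{2^{d_C}}\;\le\;\bigl(2(n_B+Nn_A)M\bigr)^{2^{d_C}-1}\bigl((n_B+Nn_A)g\bigr)^{2^{d_C}}.$$ Moreover, for fixed $A,B,C,D$, one has $\gamma(E_N)=O\bigl(N^{2^{d_C}+1}\bigr)$ as $N\to\infty$; in particular $\gamma(E_N)$ is bounded by a polynomial in $N$. -/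

import Mathlib

open Matrix

/-- The Graver basis of an integer matrix `E`: the nonzero integer vectors `v` in the kernel of `E`
that are not a sum `v = u + w` of nonzero integer kernel vectors `u`, `w` lying in the same orthant
as `v`. A common orthant containing `u`, `w` (and hence also `u + w`) exists if and only if
`0 ≤ u i * w i` for every coordinate `i`. -/
def graverBasis {m n : Type*} [Fintype n] (E : Matrix m n ℤ) : Set (n → ℤ) :=
  {v | v ≠ 0 ∧ E *ᵥ v = 0 ∧
    ¬ ∃ u w : n → ℤ, u ≠ 0 ∧ w ≠ 0 ∧ E *ᵥ u = 0 ∧ E *ᵥ w = 0 ∧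
      (∀ i, 0 ≤ u i * w i) ∧ v = u + w}

/-- The `ℓ₁`-norm of an integer vector. -/
def l1Norm {n : Type*} [Fintype n] (v : n → ℤ) : ℕ := ∑ i, (v i).natAbs

/-- The maximum `ℓ₁`-norm of an element of the Graver basis of `E` (`0` if the basis is empty).
The supremum is a maximum whenever the Graver basis is finite and nonempty. -/
noncomputable def maxGraverNorm {m n : Type*} [Fintype n] (E : Matrix m n ℤ) : ℕ :=
  sSup (l1Norm '' graverBasis E)

/-- The two-stage matrix with `N` block rows `(B 0 ⋯ A ⋯ 0)`, i.e. the four-block matrix without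
the upper block row. Row `(i, k)` is row `i` of the `k`-th block row; column `Sum.inr (j, k)` is
column `j` of the `k`-th copy of `A`. -/
def twoStage {dA nA nB : ℕ} (N : ℕ) (B : Matrix (Fin dA) (Fin nB) ℤ)
    (A : Matrix (Fin dA) (Fin nA) ℤ) :
    Matrix (Fin dA × Fin N) (Fin nB ⊕ Fin nA × Fin N) ℤ :=
  fromCols (of fun p j => B p.1 j) (blockDiagonal fun _ : Fin N => A)

/-- The `N`-fold four-block matrix: upper block row `(C D ⋯ D)`, below it the two-stage matrix. -/
def fourBlock {dA nA nB dC : ℕ} (N : ℕ) (C : Matrix (Fin dC) (Fin nB) ℤ)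
    (D : Matrix (Fin dC) (Fin nA) ℤ) (B : Matrix (Fin dA) (Fin nB) ℤ)
    (A : Matrix (Fin dA) (Fin nA) ℤ) :
    Matrix (Fin dC ⊕ Fin dA × Fin N) (Fin nB ⊕ Fin nA × Fin N) ℤ :=
  fromRows (fromCols C (of fun i q => D i q.1)) (twoStage N B A)

/-- `g` bounds, for every `N`, the absolute values of all components of all Graver basis elements
of the `N`-fold two-stage matrix built from `A` and `B`. -/
def IsTwoStageGraverBound {dA nA nB : ℕ} (A : Matrix (Fin dA) (Fin nA) ℤ)
    (B : Matrix (Fin dA) (Fin nB) ℤ) (g : ℕ) : Prop :=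
  ∀ N : ℕ, ∀ v ∈ graverBasis (twoStage N B A), ∀ i, |v i| ≤ (g : ℤ)

/-! Two independent arguments combine. Adding a row `a` with entries at most `K`: a Graver element
of the larger matrix is a conformal sum of Graver elements of the smaller one, of norm at most γ. On
these summands `a` takes integer values of size at most `K * γ` with total zero. More than `2 * K *
γ` of them would split into two nonempty zero-sum parts (`exists_zero_sum_split`), contradicting
indecomposability; so the norm is at most `2 * K * γ ^ 2` (`maxGraverNorm_le_of_add_row`). Iterating
over the rows of `(C D ⋯ D)` yields the exponents `2 ^ d - 1` and `2 ^ d`. The column count is not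
needed in the first factor, so the growth is even `O(N ^ (2 ^ d))`. The bound `g`: blocks interact
only through the first-stage part. Well-quasi-ordering of finite families of vectors leaves finitely
many first-stage parts, and over each of them the nonzero blocks form an antichain. -/

/-! ### Families of vectors ordered by domination -/

/-- The box cut out by choosing, for every member `k` of the family `Y`, a coordinate `σ k` in
which to stay strictly below `Y k`. -/
noncomputable def avoidanceBox {ι κ : Type*} [Fintype κ] [DecidableEq ι] (Y : κ → ι → ℕ)
    (σ : κ → ι) (i : ι) : ℕ∞ :=
  (Finset.univ.filter fun k => σ k = i).inf fun k => (Y k i : ℕ∞)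

/-- An empty infimum is `⊤`, so unchosen coordinates are unconstrained. As `σ` varies, the boxes
cover exactly the vectors dominating no member of `Y`. -/
theorem forall_lt_avoidanceBox_iff {ι κ : Type*} [Fintype κ] [DecidableEq ι] (Y : κ → ι → ℕ)
    (σ : κ → ι) (y : ι → ℕ) :
    (∀ i, (y i : ℕ∞) < avoidanceBox Y σ i) ↔ ∀ k, y (σ k) < Y k (σ k) := by
  simp only [avoidanceBox, Finset.lt_inf_iff (ENat.natCast_lt_top _), Finset.mem_filter,
    Finset.mem_univ, true_and, Nat.cast_lt]
  exact ⟨fun h k => h _ k rfl, fun h i k hk => hk ▸ h k⟩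

theorem List.SublistForall₂.exists_rel_of_mem {α β : Type*} {r : α → β → Prop} {l : List α}
    {m : List β} (h : List.SublistForall₂ r l m) {a : α} (ha : a ∈ l) : ∃ b ∈ m, r a b := by
  induction h with
  | nil => simp at ha
  | cons hr _ ih =>
    rcases List.mem_cons.1 ha with rfl | ha
    · exact ⟨_, by simp, hr⟩
    · obtain ⟨b, hb, hab⟩ := ih ha
      exact ⟨b, by simp [hb], hab⟩
  | cons_right _ ih =>
    obtain ⟨b, hb, hab⟩ := ih ha
    exact ⟨b, by simp [hb], hab⟩

/-- Finite families of vectors of natural numbers are well-quasi-ordered by the relation that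
every member of the later family dominates some member of the earlier one. -/
theorem exists_lt_forall_exists_le {ι : Type*} [Finite ι] {κ : ℕ → Type*} [∀ n, Finite (κ n)]
    (Y : ∀ n, κ n → ι → ℕ) : ∃ m n, m < n ∧ ∀ k' : κ n, ∃ k : κ m, Y m k ≤ Y n k' := by
  classical
  have := Fintype.ofFinite ι
  have := fun n => Fintype.ofFinite (κ n)
  -- Higman's lemma on the lists of boxes: for some `m < n`, each box of `Y m` lies in a box of `Y
  -- n`. A member of `Y n` dominating nothing in `Y m` would then avoid its own family, hence lie
  -- strictly below itself.
  let S : ℕ → List (ι → ℕ∞) := fun n =>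
    (Finset.univ : Finset (κ n → ι)).toList.map (avoidanceBox (Y n))
  have hpwo := Set.PartiallyWellOrderedOn.partiallyWellOrderedOn_sublistForall₂ (· ≤ ·)
    (Set.isPWO_of_wellQuasiOrderedLE (Set.univ : Set (ι → ℕ∞)))
  obtain ⟨m, n, hmn, h⟩ := hpwo.exists_lt (f := S) (fun n x _ => Set.mem_univ x)
  refine ⟨m, n, hmn, fun k' => ?_⟩
  by_contra! hcon
  have hσ : ∀ k, ∃ i, Y n k' i < Y m k i := fun k => by
    have := hcon k
    simpa [Pi.le_def] using this
  choose σ hσ using hσ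
  obtain ⟨b, hb, hle⟩ := h.exists_rel_of_mem (a := avoidanceBox (Y m) σ) (by simp [S])
  obtain ⟨τ, -, rfl⟩ := List.mem_map.1 hb
  have hlt := (forall_lt_avoidanceBox_iff (Y m) σ (Y n k')).2 hσ
  exact lt_irrefl _ ((forall_lt_avoidanceBox_iff (Y n) τ (Y n k')).1
    (fun i => (hlt i).trans_le (hle i)) k')

/-! ### The conformal order -/

/-- `ConformalLE u v` means that `u` lies in a common orthant with `v` and `|u i| ≤ |v i|` for
all `i`. -/
def ConformalLE {n : Type*} (u v : n → ℤ) : Prop :=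
  ∀ i, (u i).toNat ≤ (v i).toNat ∧ (-u i).toNat ≤ (-v i).toNat

/-- The positive and negative parts of an integer vector. -/
def signParts {n : Type*} (v : n → ℤ) : n ⊕ n → ℕ :=
  Sum.elim (fun i => (v i).toNat) fun i => (-v i).toNat

theorem signParts_le_iff {n : Type*} {u v : n → ℤ} : signParts u ≤ signParts v ↔ ConformalLE u v := by
  simp [signParts, ConformalLE, Pi.le_def, forall_and]

theorem wellQuasiOrdered_conformal (n : Type*) [Finite n] :
    WellQuasiOrdered (ConformalLE : (n → ℤ) → (n → ℤ) → Prop) := fun f => by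
  obtain ⟨i, j, hij, h⟩ := wellQuasiOrdered_le fun k => signParts (f k)
  exact ⟨i, j, hij, signParts_le_iff.1 h⟩

instance (n : Type*) : IsPreorder (n → ℤ) ConformalLE where
  refl _ _ := ⟨le_rfl, le_rfl⟩
  trans _ _ _ h h' i := ⟨(h i).1.trans (h' i).1, (h i).2.trans (h' i).2⟩

theorem ConformalLE.refl {n : Type*} (u : n → ℤ) : ConformalLE u u := fun _ => ⟨le_rfl, le_rfl⟩

theorem ConformalLE.trans {n : Type*} {u v w : n → ℤ} (h : ConformalLE u v) (h' : ConformalLE v w) :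
    ConformalLE u w := fun i => ⟨(h i).1.trans (h' i).1, (h i).2.trans (h' i).2⟩

theorem conformal_iff {n : Type*} {u v : n → ℤ} :
    ConformalLE u v ↔ ∀ i, 0 ≤ u i ∧ u i ≤ v i ∨ u i ≤ 0 ∧ v i ≤ u i :=
  forall_congr' fun i => by omega

theorem conformal_add_iff {n : Type*} {u w : n → ℤ} :
    ConformalLE u (u + w) ↔ ∀ i, 0 ≤ u i * w i := by
  rw [conformal_iff]
  refine forall_congr' fun i => ?_
  rw [mul_nonneg_iff, Pi.add_apply]
  omega

theorem ConformalLE.sub {n : Type*} {u v : n → ℤ} (h : ConformalLE u v) : ConformalLE (v - u) v := by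
  intro i
  have := h i
  simp only [Pi.sub_apply]
  omega

theorem ConformalLE.l1Norm_sub_lt {n : Type*} [Fintype n] {u v : n → ℤ} (h : ConformalLE u v)
    (hu : u ≠ 0) : l1Norm (v - u) < l1Norm v := by
  obtain ⟨i, hi⟩ := Function.ne_iff.1 hu
  refine Finset.sum_lt_sum (fun j _ => ?_) ⟨i, Finset.mem_univ _, ?_⟩
  · have := h j
    simp only [Pi.sub_apply]
    omega
  · have := h i
    simp only [Pi.sub_apply, Pi.zero_apply] at hi ⊢
    omega

/-! ### Graver bases -/

/-- Taking `w = v - u` turns a decomposition into a smaller conformal kernel vector: Graver elements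
are the conformally minimal ones. -/
theorem mem_graverBasis_iff {m n : Type*} [Fintype n] {E : Matrix m n ℤ} {v : n → ℤ} :
    v ∈ graverBasis E ↔
      v ≠ 0 ∧ E *ᵥ v = 0 ∧ ∀ u, u ≠ 0 → E *ᵥ u = 0 → ConformalLE u v → u = v := by
  refine and_congr_right fun hv => and_congr_right fun hE => ⟨fun h u hu hEu hc => ?_, ?_⟩
  · by_contra hne
    refine h ⟨u, v - u, hu, sub_ne_zero.2 (Ne.symm hne), hEu, by simp [mulVec_sub, hE, hEu], ?_,
      by simp⟩
    rw [← conformal_add_iff]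
    simpa using hc
  · rintro h ⟨u, w, hu, hw, hEu, -, hc, rfl⟩
    exact hw (by simpa using h u hu hEu (conformal_add_iff.2 hc))

theorem finite_of_conformal_imp_eq {n : Type*} [Finite n] {S : Set (n → ℤ)}
    (hS : ∀ u ∈ S, ∀ v ∈ S, ConformalLE u v → u = v) : S.Finite :=
  IsAntichain.finite_of_wellQuasiOrdered (fun u hu v hv hne h => hne (hS u hu v hv h))
    (wellQuasiOrdered_conformal n)

theorem finite_graverBasis {m n : Type*} [Fintype n] (E : Matrix m n ℤ) :
    (graverBasis E).Finite :=
  finite_of_conformal_imp_eq fun u hu _ hv h =>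
    (mem_graverBasis_iff.1 hv).2.2 u hu.1 hu.2.1 h

theorem l1Norm_le_maxGraverNorm {m n : Type*} [Fintype n] {E : Matrix m n ℤ} {v : n → ℤ}
    (hv : v ∈ graverBasis E) : l1Norm v ≤ maxGraverNorm E :=
  le_csSup ((finite_graverBasis E).image _).bddAbove ⟨v, hv, rfl⟩

theorem maxGraverNorm_le {m n : Type*} [Fintype n] {E : Matrix m n ℤ} {b : ℕ}
    (h : ∀ v ∈ graverBasis E, l1Norm v ≤ b) : maxGraverNorm E ≤ b :=
  csSup_le' (by rintro _ ⟨v, hv, rfl⟩; exact h v hv)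

theorem l1Norm_pos {n : Type*} [Fintype n] {v : n → ℤ} (hv : v ≠ 0) : 0 < l1Norm v := by
  obtain ⟨i, hi⟩ := Function.ne_iff.1 hv
  exact Finset.sum_pos' (fun _ _ => Nat.zero_le _) ⟨i, Finset.mem_univ _, Int.natAbs_pos.2 hi⟩

/-- Every nonzero integer kernel vector dominates a Graver basis element. -/
theorem exists_mem_graverBasis_conformal {m n : Type*} [Fintype n] {E : Matrix m n ℤ}
    (v : n → ℤ) (hv : v ≠ 0) (hE : E *ᵥ v = 0) : ∃ g ∈ graverBasis E, ConformalLE g v := by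
  by_cases h : v ∈ graverBasis E
  · exact ⟨v, h, .refl v⟩
  · rw [mem_graverBasis_iff] at h
    push Not at h
    obtain ⟨u, hu, hEu, hc, hne⟩ := h hv hE
    have hlt : l1Norm u < l1Norm v := by
      simpa using hc.sub.l1Norm_sub_lt (sub_ne_zero.2 hne.symm)
    obtain ⟨g, hg, hgu⟩ := exists_mem_graverBasis_conformal u hu hEu
    exact ⟨g, hg, hgu.trans hc⟩
termination_by l1Norm v

/-- Every integer kernel vector is a conformal sum of Graver basis elements. -/
theorem exists_conformal_graver_sum {m n : Type*} [Fintype n] {E : Matrix m n ℤ}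
    (v : n → ℤ) (hE : E *ᵥ v = 0) :
    ∃ s : Multiset (n → ℤ), (∀ g ∈ s, g ∈ graverBasis E ∧ ConformalLE g v) ∧ s.sum = v := by
  by_cases hv : v = 0
  · exact ⟨0, by simp, by simp [hv]⟩
  · obtain ⟨g, hg, hc⟩ := exists_mem_graverBasis_conformal v hv hE
    have hlt := hc.l1Norm_sub_lt hg.1
    obtain ⟨s, hs, hsum⟩ := exists_conformal_graver_sum (E := E) (v - g)
      (by simp [mulVec_sub, hE, hg.2.1])
    refine ⟨g ::ₘ s, fun h hh => ?_, by simp [hsum]⟩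
    rcases Multiset.mem_cons.1 hh with rfl | hh
    · exact ⟨hg, hc⟩
    · exact ⟨(hs h hh).1, (hs h hh).2.trans hc.sub⟩
termination_by l1Norm v

/-! ### Zero-sum submultisets -/

/-- A multiset of nonzero integers bounded by `m` can be enumerated so that, starting from
`c ∈ (-m, m]` and ending in `0`, all partial sums stay in `(-m, m]`. -/
theorem exists_list_prefix_sum_mem_Ioc {α : Type*} (f : α → ℤ) (m : ℤ) (s : Multiset α) (c : ℤ)
    (hs : ∀ x ∈ s, f x ≠ 0 ∧ |f x| ≤ m) (hc : c ∈ Set.Ioc (-m) m) (hsum : c + (s.map f).sum = 0) :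
    ∃ l : List α, (l : Multiset α) = s ∧
      ∀ k, c + ((l.take k).map f).sum ∈ Set.Ioc (-m) m := by
  classical
  by_cases h0 : s = 0
  · exact ⟨[], by simp [h0], by simpa using hc⟩
  -- A term of sign opposite to `c` (positive if `c = 0`) keeps the sum in range; without one, the
  -- total could not be zero.
  have hx : ∃ x ∈ s, c + f x ∈ Set.Ioc (-m) m := by
    by_contra! hcon
    rcases le_or_gt c 0 with h | h
    · have hneg : ∀ x ∈ s, f x < 0 := fun x hx => by
        have h1 := hs x hx
        have h2 := hcon x hx
        simp only [Set.mem_Ioc, abs_le, ne_eq] at *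
        omega
      have : (s.map f).sum < (s.map fun _ => (0 : ℤ)).sum :=
        Multiset.sum_lt_sum_of_nonempty h0 hneg
      simp at this
      omega
    · have hpos : ∀ x ∈ s, 0 < f x := fun x hx => by
        have h1 := hs x hx
        have h2 := hcon x hx
        simp only [Set.mem_Ioc, abs_le, ne_eq] at *
        omega
      have : (s.map fun _ => (0 : ℤ)).sum < (s.map f).sum :=
        Multiset.sum_lt_sum_of_nonempty h0 hpos
      simp at this
      omega
  obtain ⟨x, hxs, hx⟩ := hx
  obtain ⟨t, rfl⟩ := Multiset.exists_cons_of_mem hxs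
  obtain ⟨l, rfl, hl⟩ := exists_list_prefix_sum_mem_Ioc f m t (c + f x)
    (fun y hy => hs y (Multiset.mem_cons_of_mem hy)) hx (by simpa [add_assoc] using hsum)
  refine ⟨x :: l, rfl, fun k => ?_⟩
  cases k with
  | zero => simpa using hc
  | succ k => simpa [add_assoc] using hl k
termination_by s.card

/-- A multiset with zero sum of integers bounded by `m`, of cardinality more than `max 1 (2 * m)`,
splits into two nonempty parts with zero sum. -/
theorem exists_zero_sum_split {α : Type*} (f : α → ℤ) (m : ℕ) (s : Multiset α)
    (hs : ∀ x ∈ s, |f x| ≤ m) (hsum : (s.map f).sum = 0) (h1 : 1 < s.card)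
    (h2 : 2 * m < s.card) :
    ∃ t u : Multiset α, t ≠ 0 ∧ u ≠ 0 ∧ s = t + u ∧ (t.map f).sum = 0 ∧ (u.map f).sum = 0 := by
  classical
  by_cases hz : ∃ x ∈ s, f x = 0
  · obtain ⟨x, hx, hfx⟩ := hz
    obtain ⟨t, rfl⟩ := Multiset.exists_cons_of_mem hx
    refine ⟨{x}, t, by simp, ?_, by simp, by simp [hfx], by simpa [hfx] using hsum⟩
    rintro rfl
    simp at h1
  push Not at hz
  have hm : 0 < m := by
    obtain ⟨x, hx⟩ := Multiset.exists_mem_of_ne_zero (s := s) (by rintro rfl; simp at h1)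
    have := abs_pos.2 (hz x hx)
    have := hs x hx
    omega
  obtain ⟨l, rfl, hl⟩ := exists_list_prefix_sum_mem_Ioc f m s 0
    (fun x hx => ⟨hz x hx, hs x hx⟩) (by simp [hm]) (by simpa using hsum)
  simp only [zero_add] at hl
  -- Pigeonhole: the interval has `2 * m` integers. The full prefix is excluded, so the complement
  -- of the zero-sum segment is nonempty.
  obtain ⟨i, hi, j, hj, hne, heq⟩ := Finset.exists_ne_map_eq_of_card_lt_of_maps_to
    (s := Finset.range l.length) (t := Finset.Ioc (-(m : ℤ)) m)
    (f := fun k => ((l.take k).map f).sum)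
    (by simp at h2 ⊢; omega) (fun k _ => by simpa using hl k)
  wlog hij : i < j generalizing i j
  · exact this j hj i hi hne.symm heq.symm (by omega)
  simp only [Finset.mem_range] at hi hj
  have hdec : l = l.take i ++ ((l.take j).drop i ++ l.drop j) := by
    rw [← List.append_assoc]
    conv_lhs => rw [← List.take_append_drop j l, ← List.take_append_drop i (l.take j)]
    rw [List.take_take, min_eq_left hij.le]
  have hmid : (((l.take j).drop i).map f).sum = 0 := by
    have : l.take j = l.take i ++ (l.take j).drop i := by
      conv_lhs => rw [← List.take_append_drop i (l.take j)]
      rw [List.take_take, min_eq_left hij.le]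
    have h3 : ((l.take j).map f).sum = ((l.take i).map f).sum + (((l.take j).drop i).map f).sum := by
      conv_lhs => rw [this]
      simp
    omega
  refine ⟨((l.take j).drop i : List α), (l.take i ++ l.drop j : List α), ?_, ?_, ?_,
    by simpa using hmid, ?_⟩
  · rw [Ne, Multiset.coe_eq_zero, ← List.length_eq_zero_iff]
    simp
    omega
  · rw [Ne, Multiset.coe_eq_zero, ← List.length_eq_zero_iff]
    simp
    omega
  · conv_lhs => rw [hdec]
    simp only [← Multiset.coe_add]
    abel
  · have h4 := hsum
    rw [hdec] at h4
    simp only [Multiset.map_coe, Multiset.sum_coe, List.map_append, List.sum_append] at h4 ⊢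
    omega

/-! ### Appending rows to a matrix -/

/-- Summands in the orthant of `v` cannot cancel; this makes the two parts of a split a forbidden
decomposition. -/
theorem sum_nonneg_of_conformalLE {n : Type*} {v : n → ℤ} {s : Multiset (n → ℤ)}
    (hs : ∀ g ∈ s, ConformalLE g v) {i : n} (hi : 0 ≤ v i) : 0 ≤ s.sum i := by
  refine Multiset.sum_induction (fun w : n → ℤ => 0 ≤ w i) s (fun _ _ => add_nonneg) le_rfl
    fun g hg => ?_
  have := hs g hg i
  omega

theorem sum_nonpos_of_conformalLE {n : Type*} {v : n → ℤ} {s : Multiset (n → ℤ)}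
    (hs : ∀ g ∈ s, ConformalLE g v) {i : n} (hi : v i ≤ 0) : s.sum i ≤ 0 := by
  refine Multiset.sum_induction (fun w : n → ℤ => w i ≤ 0) s (fun _ _ => add_nonpos) le_rfl
    fun g hg => ?_
  have := hs g hg i
  omega

theorem sum_ne_zero_of_conformalLE {n : Type*} {v : n → ℤ} {s : Multiset (n → ℤ)}
    (hs : ∀ g ∈ s, ConformalLE g v) (hs0 : ∀ g ∈ s, g ≠ 0) (hne : s ≠ 0) : s.sum ≠ 0 := by
  obtain ⟨g, hg⟩ := Multiset.exists_mem_of_ne_zero hne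
  obtain ⟨t, rfl⟩ := Multiset.exists_cons_of_mem hg
  obtain ⟨i, hi⟩ := Function.ne_iff.1 (hs0 g hg)
  refine Function.ne_iff.2 ⟨i, ?_⟩
  have ht : ∀ h ∈ t, ConformalLE h v := fun h hh => hs h (Multiset.mem_cons_of_mem hh)
  have h1 := hs g hg i
  simp only [Multiset.sum_cons, Pi.add_apply, Pi.zero_apply] at hi ⊢
  rcases le_total 0 (v i) with h | h
  · have := sum_nonneg_of_conformalLE ht h
    omega
  · have := sum_nonpos_of_conformalLE ht h
    omega

theorem sum_mul_sum_nonneg_of_conformalLE {n : Type*} {v : n → ℤ} {s t : Multiset (n → ℤ)}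
    (hs : ∀ g ∈ s, ConformalLE g v) (ht : ∀ g ∈ t, ConformalLE g v) (i : n) :
    0 ≤ s.sum i * t.sum i := by
  rcases le_total 0 (v i) with h | h
  · exact mul_nonneg (sum_nonneg_of_conformalLE hs h) (sum_nonneg_of_conformalLE ht h)
  · exact mul_nonneg_of_nonpos_of_nonpos (sum_nonpos_of_conformalLE hs h)
      (sum_nonpos_of_conformalLE ht h)

theorem l1Norm_multiset_sum_le {n : Type*} [Fintype n] (s : Multiset (n → ℤ)) {b : ℕ}
    (hs : ∀ g ∈ s, l1Norm g ≤ b) : l1Norm s.sum ≤ s.card * b := by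
  have h1 : l1Norm s.sum ≤ (s.map l1Norm).sum :=
    Multiset.le_sum_of_subadditive l1Norm (by simp [l1Norm]) (fun u v => by
      simp only [l1Norm, ← Finset.sum_add_distrib]
      exact Finset.sum_le_sum fun i _ => Int.natAbs_add_le _ _) s
  refine h1.trans ?_
  simpa using Multiset.sum_le_card_nsmul (s.map l1Norm) b (by simpa using hs)

theorem abs_dotProduct_le_mul_l1Norm {n : Type*} [Fintype n] {a : n → ℤ} {K : ℕ}
    (ha : ∀ j, |a j| ≤ K) (v : n → ℤ) : |a ⬝ᵥ v| ≤ K * l1Norm v := by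
  simp only [dotProduct, l1Norm, Nat.cast_sum, Finset.mul_sum, Int.natCast_natAbs]
  refine (Finset.abs_sum_le_sum_abs _ _).trans (Finset.sum_le_sum fun i _ => ?_)
  rw [abs_mul]
  exact mul_le_mul_of_nonneg_right (ha i) (abs_nonneg _)

/-- Adding one row with entries bounded by `K` to a matrix at most squares the maximal norm of
Graver basis elements, up to the factor `2 * K`. -/
theorem maxGraverNorm_le_of_add_row {m m' n : Type*} [Fintype n] {E : Matrix m n ℤ}
    {E' : Matrix m' n ℤ} {a : n → ℤ} {K : ℕ} (hK : 1 ≤ K) (ha : ∀ j, |a j| ≤ K)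
    (hker : ∀ v, E' *ᵥ v = 0 ↔ a ⬝ᵥ v = 0 ∧ E *ᵥ v = 0) :
    maxGraverNorm E' ≤ 2 * K * maxGraverNorm E ^ 2 := by
  refine maxGraverNorm_le fun v hv => ?_
  obtain ⟨hav, hEv⟩ := (hker v).1 hv.2.1
  obtain ⟨s, hs, hsum⟩ := exists_conformal_graver_sum v hEv
  have hnorm : ∀ g ∈ s, l1Norm g ≤ maxGraverNorm E := fun g hg =>
    l1Norm_le_maxGraverNorm (hs g hg).1
  have hdot : ∀ t : Multiset (n → ℤ), a ⬝ᵥ t.sum = (t.map (a ⬝ᵥ ·)).sum := fun t => by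
    induction t using Multiset.induction with
    | empty => simp
    | cons g t ih => simp [dotProduct_add, ih]
  have hmem : ∀ t ≤ s, (t.map (a ⬝ᵥ ·)).sum = 0 → E' *ᵥ t.sum = 0 := fun t ht h0 =>
    (hker _).2 ⟨(hdot t).trans h0, Multiset.sum_induction (fun w => E *ᵥ w = 0) t
      (fun u w hu hw => by rw [mulVec_add, hu, hw, add_zero]) (mulVec_zero E)
      fun g hg => (hs g (Multiset.mem_of_le ht hg)).1.2.1⟩
  have hpos : 1 ≤ maxGraverNorm E := by
    obtain ⟨g, hg⟩ := Multiset.exists_mem_of_ne_zero (s := s) (by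
      rintro rfl
      exact hv.1 (by simpa using hsum.symm))
    exact (l1Norm_pos (hs g hg).1.1).trans_le (hnorm g hg)
  have hcard : s.card ≤ 2 * (K * maxGraverNorm E) := by
    by_contra! hlt
    have hKpos : 1 ≤ K * maxGraverNorm E := Nat.mul_pos hK hpos
    obtain ⟨t, u, ht0, hu0, htu, ht, hu⟩ := exists_zero_sum_split (a ⬝ᵥ ·) (K * maxGraverNorm E) s
      (fun g hg => (abs_dotProduct_le_mul_l1Norm ha g).trans
        (by exact_mod_cast Nat.mul_le_mul_left K (hnorm g hg)))
      (by rw [← hdot, hsum, hav]) (by omega) hlt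
    have hts : t ≤ s := htu ▸ Multiset.le_add_right t u
    have hus : u ≤ s := htu ▸ Multiset.le_add_left u t
    have hct : ∀ g ∈ t, ConformalLE g v := fun g hg => (hs g (Multiset.mem_of_le hts hg)).2
    have hcu : ∀ g ∈ u, ConformalLE g v := fun g hg => (hs g (Multiset.mem_of_le hus hg)).2
    exact hv.2.2 ⟨t.sum, u.sum,
      sum_ne_zero_of_conformalLE hct (fun g hg => (hs g (Multiset.mem_of_le hts hg)).1.1) ht0,
      sum_ne_zero_of_conformalLE hcu (fun g hg => (hs g (Multiset.mem_of_le hus hg)).1.1) hu0,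
      hmem t hts ht, hmem u hus hu, sum_mul_sum_nonneg_of_conformalLE hct hcu,
      by rw [← hsum, htu, Multiset.sum_add]⟩
  calc l1Norm v = l1Norm s.sum := by rw [hsum]
    _ ≤ s.card * maxGraverNorm E := l1Norm_multiset_sum_le s hnorm
    _ ≤ 2 * (K * maxGraverNorm E) * maxGraverNorm E := Nat.mul_le_mul_right _ hcard
    _ = 2 * K * maxGraverNorm E ^ 2 := by ring

theorem fromRows_mulVec_eq_zero_iff {m₁ m₂ n : Type*} [Fintype n] (R : Matrix m₁ n ℤ)
    (E : Matrix m₂ n ℤ) (v : n → ℤ) :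
    fromRows R E *ᵥ v = 0 ↔ R *ᵥ v = 0 ∧ E *ᵥ v = 0 := by
  simp [funext_iff, fromRows_mulVec]

/-- Adding `d` rows with entries bounded by `K` to a matrix. -/
theorem maxGraverNorm_fromRows_le {m n : Type*} [Fintype n] (E : Matrix m n ℤ) {K : ℕ}
    (hK : 1 ≤ K) {d : ℕ} (R : Matrix (Fin d) n ℤ) (hR : ∀ i j, |R i j| ≤ K) :
    maxGraverNorm (fromRows R E) ≤ (2 * K) ^ (2 ^ d - 1) * maxGraverNorm E ^ (2 ^ d) := by
  induction d with
  | zero =>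
    have : graverBasis (fromRows R E) = graverBasis E := by
      ext v
      have : ∀ v, fromRows R E *ᵥ v = 0 ↔ E *ᵥ v = 0 := fun v => by
        rw [fromRows_mulVec_eq_zero_iff, and_iff_right (Subsingleton.elim _ _)]
      simp only [graverBasis, this]
    simp [maxGraverNorm, this]
  | succ d ih =>
    let R' : Matrix (Fin d) n ℤ := of fun i j => R i.succ j
    have hstep := maxGraverNorm_le_of_add_row (E := fromRows R' E) (E' := fromRows R E)
      (a := R 0) hK (hR 0) fun v => by
        rw [fromRows_mulVec_eq_zero_iff, fromRows_mulVec_eq_zero_iff, ← and_assoc]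
        refine and_congr_left fun _ => ?_
        rw [funext_iff, Fin.forall_fin_succ, funext_iff]
        rfl
    -- Squaring doubles the exponent of `2 * K`, and the new row contributes one more factor.
    have hpow : 2 ^ (d + 1) - 1 = 1 + (2 ^ d - 1) * 2 := by
      have := Nat.one_le_two_pow (n := d)
      rw [pow_succ]
      omega
    calc maxGraverNorm (fromRows R E) ≤ 2 * K * maxGraverNorm (fromRows R' E) ^ 2 := hstep
      _ ≤ 2 * K * ((2 * K) ^ (2 ^ d - 1) * maxGraverNorm E ^ (2 ^ d)) ^ 2 := by
        gcongr
        exact ih R' fun i j => hR _ _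
      _ = (2 * K) ^ (2 ^ (d + 1) - 1) * maxGraverNorm E ^ (2 ^ (d + 1)) := by
        rw [hpow, mul_pow, ← pow_mul, ← pow_mul, pow_add, pow_one, pow_succ 2 d, ← mul_assoc]

/-! ### Two-stage matrices -/

theorem twoStage_mulVec_eq_zero_iff {dA nA nB N : ℕ} (A : Matrix (Fin dA) (Fin nA) ℤ)
    (B : Matrix (Fin dA) (Fin nB) ℤ) (v : Fin nB ⊕ Fin nA × Fin N → ℤ) :
    twoStage N B A *ᵥ v = 0 ↔
      ∀ k, B *ᵥ (fun j => v (Sum.inl j)) + A *ᵥ (fun j => v (Sum.inr (j, k))) = 0 := by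
  simp only [funext_iff, Prod.forall, twoStage, fromCols_mulVec, Pi.add_apply, Pi.zero_apply]
  rw [forall_comm]
  refine forall_congr' fun k => forall_congr' fun i => ?_
  simp [mulVec, dotProduct, blockDiagonal_apply, Fintype.sum_prod_type]

/-- The first-stage parts of the Graver basis elements of all two-stage matrices built from
`A` and `B`. -/
def firstStageParts {dA nA nB : ℕ} (A : Matrix (Fin dA) (Fin nA) ℤ)
    (B : Matrix (Fin dA) (Fin nB) ℤ) : Set (Fin nB → ℤ) :=
  {x | ∃ N, ∃ v ∈ graverBasis (twoStage N B A), (fun j => v (Sum.inl j)) = x}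

/-- The second-stage blocks of the Graver basis elements of all two-stage matrices built from
`A` and `B` that have first-stage part `x`. -/
def secondStageParts {dA nA nB : ℕ} (A : Matrix (Fin dA) (Fin nA) ℤ)
    (B : Matrix (Fin dA) (Fin nB) ℤ) (x : Fin nB → ℤ) : Set (Fin nA → ℤ) :=
  {y | ∃ N, ∃ v ∈ graverBasis (twoStage N B A), (fun j => v (Sum.inl j)) = x ∧
    ∃ k, (fun j => v (Sum.inr (j, k))) = y}

/-- From infinitely many parts, take a conformally increasing sequence and then `i < j` such that
every block of the later vector dominates a block of the earlier one. These blocks, repeated as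
needed, together with `x (g i)` form a kernel vector below the later vector; minimality forces equal
first-stage parts. -/
theorem finite_firstStageParts {dA nA nB : ℕ} (A : Matrix (Fin dA) (Fin nA) ℤ)
    (B : Matrix (Fin dA) (Fin nB) ℤ) : (firstStageParts A B).Finite := by
  by_contra hinf
  have hinf' : (firstStageParts A B \ {0}).Infinite :=
    Set.Infinite.sdiff hinf (Set.finite_singleton 0)
  let x : ℕ → Fin nB → ℤ := fun i => hinf'.natEmbedding _ i
  have hx0 : ∀ i, x i ≠ 0 := fun i => (hinf'.natEmbedding _ i).2.2
  have hxinj : Function.Injective x :=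
    Subtype.val_injective.comp (hinf'.natEmbedding _).injective
  have hxmem : ∀ i, x i ∈ firstStageParts A B := fun i => (hinf'.natEmbedding _ i).2.1
  choose N v hv hvx using hxmem
  obtain ⟨g, hg⟩ := (wellQuasiOrdered_conformal (Fin nB)).exists_monotone_subseq x
  obtain ⟨i, j, hij, h⟩ := exists_lt_forall_exists_le (κ := fun i => Fin (N (g i)))
    fun i k => signParts fun l => v (g i) (Sum.inr (l, k))
  choose σ hσ using h
  have hne : x (g i) ≠ x (g j) := fun h => hij.ne (g.injective (hxinj h))
  have hconf := hg i j hij.le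
  let u : Fin nB ⊕ Fin nA × Fin (N (g j)) → ℤ :=
    Sum.elim (x (g i)) fun p => v (g i) (Sum.inr (p.1, σ p.2))
  have hu : u = v (g j) := by
    refine (mem_graverBasis_iff.1 (hv (g j))).2.2 u (fun h0 => hx0 (g i) ?_) ?_ ?_
    · exact funext fun l => congrFun h0 (Sum.inl l)
    · rw [twoStage_mulVec_eq_zero_iff]
      intro k
      have := (twoStage_mulVec_eq_zero_iff A B _).1 (hv (g i)).2.1 (σ k)
      rwa [hvx] at this
    · rintro (l | ⟨l, k⟩)
      · have := hconf l
        rwa [← hvx (g j)] at this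
      · exact signParts_le_iff.1 (hσ k) l
  apply hne
  rw [← hvx (g j), ← hu]
  rfl

/-- All blocks over `x` solve the same system, so a block may be exchanged for a conformally smaller
one; minimality forces equality. -/
theorem finite_secondStageParts {dA nA nB : ℕ} (A : Matrix (Fin dA) (Fin nA) ℤ)
    (B : Matrix (Fin dA) (Fin nB) ℤ) (x : Fin nB → ℤ) : (secondStageParts A B x).Finite := by
  suffices h : (secondStageParts A B x \ {0}).Finite from
    Set.Finite.of_sdiff h (Set.finite_singleton 0)
  refine finite_of_conformal_imp_eq ?_
  rintro y' ⟨⟨N', v', hv', hx', k', hy'⟩, hy'0⟩ y ⟨⟨N, v, hv, hx, k, hy⟩, -⟩ hc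
  have hker' := (twoStage_mulVec_eq_zero_iff A B v').1 hv'.2.1 k'
  rw [hx', hy'] at hker'
  have hker := (twoStage_mulVec_eq_zero_iff A B v).1 hv.2.1
  rw [hx] at hker
  -- For `x = 0` the other blocks are cleared, but keeping them would also work: `y' ≠ 0` already
  -- gives `u ≠ 0`.
  let u : Fin nB ⊕ Fin nA × Fin N → ℤ :=
    Sum.elim x fun p => if p.2 = k then y' p.1 else if x = 0 then 0 else v (Sum.inr p)
  have huk : (fun j => u (Sum.inr (j, k))) = y' := by simp [u]
  have hu : u = v := by
    refine (mem_graverBasis_iff.1 hv).2.2 u (fun h0 => hy'0 ?_) ?_ ?_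
    · rw [← huk, h0]
      rfl
    · rw [twoStage_mulVec_eq_zero_iff]
      intro l
      change B *ᵥ x + _ = 0
      by_cases hl : l = k
      · subst hl
        rw [huk, hker']
      · by_cases hx0 : x = 0
        · have : (fun j => u (Sum.inr (j, l))) = 0 := by
            ext j
            simp [u, hl, hx0]
          rw [this, hx0]
          simp
        · have : (fun j => u (Sum.inr (j, l))) = fun j => v (Sum.inr (j, l)) := by
            ext j
            simp [u, hl, hx0]
          rw [this, hker l]
    · rintro (l | ⟨j, l⟩)
      · simp [u, ← hx]
      · by_cases hl : l = k
        · subst hl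
          have := hc j
          rw [← hy] at this
          simpa [u] using this
        · by_cases hx0 : x = 0 <;> simp [u, hl, hx0]
  rw [← huk, hu, hy]

/-- The components of the Graver basis elements of two-stage matrices are bounded independently
of the number of blocks. -/
theorem exists_isTwoStageGraverBound {dA nA nB : ℕ} (A : Matrix (Fin dA) (Fin nA) ℤ)
    (B : Matrix (Fin dA) (Fin nB) ℤ) : ∃ g : ℕ, IsTwoStageGraverBound A B g := by
  have hX := finite_firstStageParts A B
  have hY := hX.biUnion fun x _ => finite_secondStageParts A B x
  obtain ⟨a, ha⟩ := (hX.image l1Norm).bddAbove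
  obtain ⟨b, hb⟩ := (hY.image l1Norm).bddAbove
  have hle : ∀ {n : ℕ} (w : Fin n → ℤ) (j : Fin n) {c : ℕ}, l1Norm w ≤ c → |w j| ≤ (c : ℤ) := by
    intro n w j c h
    have h1 : (w j).natAbs ≤ l1Norm w :=
      Finset.single_le_sum (f := fun j => (w j).natAbs) (fun _ _ => Nat.zero_le _)
        (Finset.mem_univ j)
    rw [Int.abs_eq_natAbs]
    exact_mod_cast h1.trans h
  refine ⟨a + b, fun N v hv => ?_⟩
  have hvX : (fun j => v (Sum.inl j)) ∈ firstStageParts A B := ⟨N, v, hv, rfl⟩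
  rintro (j | ⟨j, k⟩)
  · exact hle (fun j => v (Sum.inl j)) j ((ha ⟨_, hvX, rfl⟩).trans (Nat.le_add_right _ _))
  · exact hle (fun j => v (Sum.inr (j, k))) j ((hb ⟨_, Set.mem_biUnion hvX
      ⟨N, v, hv, rfl, k, rfl⟩, rfl⟩).trans (Nat.le_add_left _ _))

theorem maxGraverNorm_twoStage_le {dA nA nB : ℕ} {A : Matrix (Fin dA) (Fin nA) ℤ}
    {B : Matrix (Fin dA) (Fin nB) ℤ} {g : ℕ} (hg : IsTwoStageGraverBound A B g) (N : ℕ) :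
    maxGraverNorm (twoStage N B A) ≤ (nB + N * nA) * g := by
  refine maxGraverNorm_le fun v hv => ?_
  have h := Finset.sum_le_card_nsmul Finset.univ (fun i => (v i).natAbs) g fun i _ => by
    have := hg N v hv i
    rw [Int.abs_eq_natAbs] at this
    exact_mod_cast this
  simpa [l1Norm, mul_comm nA N] using h

/-- The maximal norm of Graver basis elements of a four-block matrix, in terms of a natural
number bounding the entries of the upper block row. -/
theorem maxGraverNorm_fourBlock_le {dA nA nB dC : ℕ} (N : ℕ) (C : Matrix (Fin dC) (Fin nB) ℤ)
    (D : Matrix (Fin dC) (Fin nA) ℤ) (B : Matrix (Fin dA) (Fin nB) ℤ)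
    (A : Matrix (Fin dA) (Fin nA) ℤ) {K : ℕ} (hK : 1 ≤ K) (hC : ∀ i j, |C i j| ≤ K)
    (hD : ∀ i j, |D i j| ≤ K) :
    maxGraverNorm (fourBlock N C D B A) ≤
      (2 * K) ^ (2 ^ dC - 1) * maxGraverNorm (twoStage N B A) ^ (2 ^ dC) := by
  refine maxGraverNorm_fromRows_le _ hK _ fun i j => ?_
  rcases j with j | j
  · exact hC i j
  · exact hD i j.1

theorem maxGraverNorm_fourBlock_le_real {dA nA nB dC : ℕ} (N : ℕ) (C : Matrix (Fin dC) (Fin nB) ℤ)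
    (D : Matrix (Fin dC) (Fin nA) ℤ) (B : Matrix (Fin dA) (Fin nB) ℤ)
    (A : Matrix (Fin dA) (Fin nA) ℤ) {M : ℝ} (hM : 1 ≤ M) (hC : ∀ i j, |(C i j : ℝ)| ≤ M)
    (hD : ∀ i j, |(D i j : ℝ)| ≤ M) :
    (maxGraverNorm (fourBlock N C D B A) : ℝ) ≤
      (2 * ((nB : ℝ) + N * nA) * M) ^ (2 ^ dC - 1) *
        (maxGraverNorm (twoStage N B A) : ℝ) ^ (2 ^ dC) := by
  -- Passing from `2 * ⌊M⌋₊` to the coarser base needs at least one column.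
  by_cases h0 : nB + N * nA = 0
  · have hempty : IsEmpty (Fin nB ⊕ Fin nA × Fin N) := by
      rw [← Fintype.card_eq_zero_iff]
      simpa [mul_comm nA N] using h0
    have : maxGraverNorm (fourBlock N C D B A) = 0 :=
      Nat.le_zero.1 (maxGraverNorm_le fun v hv => absurd (Subsingleton.elim v 0) hv.1)
    rw [this, Nat.cast_zero]
    positivity
  have hn : (1 : ℝ) ≤ (nB : ℝ) + N * nA := by exact_mod_cast Nat.one_le_iff_ne_zero.2 h0
  have hfloor : ∀ z : ℤ, |(z : ℝ)| ≤ M → |z| ≤ (⌊M⌋₊ : ℤ) := fun z hz => by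
    rw [Int.abs_eq_natAbs]
    have : z.natAbs ≤ ⌊M⌋₊ := Nat.le_floor (by simpa [Nat.cast_natAbs] using hz)
    exact_mod_cast this
  have h := maxGraverNorm_fourBlock_le N C D B A (K := ⌊M⌋₊) (Nat.one_le_floor_iff M |>.2 hM)
    (fun i j => hfloor _ (hC i j)) fun i j => hfloor _ (hD i j)
  calc (maxGraverNorm (fourBlock N C D B A) : ℝ)
      ≤ (2 * (⌊M⌋₊ : ℝ)) ^ (2 ^ dC - 1) * (maxGraverNorm (twoStage N B A) : ℝ) ^ (2 ^ dC) := by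
        exact_mod_cast h
    _ ≤ _ := by
        have hfl := Nat.floor_le (zero_le_one.trans hM)
        gcongr ?_ ^ _ * _
        nlinarith

/-- For fixed blocks with `d` rows in the upper block row, the maximal norm of Graver basis
elements grows at most like `N ^ (2 ^ d)`. -/
theorem isBigO_maxGraverNorm_fourBlock {dA nA nB dC : ℕ} (C : Matrix (Fin dC) (Fin nB) ℤ)
    (D : Matrix (Fin dC) (Fin nA) ℤ) (B : Matrix (Fin dA) (Fin nB) ℤ)
    (A : Matrix (Fin dA) (Fin nA) ℤ) :
    (fun N : ℕ => (maxGraverNorm (fourBlock N C D B A) : ℝ)) =O[Filter.atTop]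
      (fun N : ℕ => (N : ℝ) ^ (2 ^ dC)) := by
  obtain ⟨g, hg⟩ := exists_isTwoStageGraverBound A B
  obtain ⟨a, ha⟩ := (Set.finite_range fun p : Fin dC × Fin nB => |C p.1 p.2|).bddAbove
  obtain ⟨b, hb⟩ := (Set.finite_range fun p : Fin dC × Fin nA => |D p.1 p.2|).bddAbove
  -- If a block has no entries, `a` or `b` is arbitrary, possibly negative; the `+ 1` secures `1 ≤
  -- K`.
  let K : ℕ := a.natAbs + b.natAbs + 1
  have hC : ∀ i j, |C i j| ≤ K := fun i j => (ha ⟨(i, j), rfl⟩).trans (by omega)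
  have hD : ∀ i j, |D i j| ≤ K := fun i j => (hb ⟨(i, j), rfl⟩).trans (by omega)
  refine Asymptotics.IsBigO.of_bound
    ((2 * K : ℝ) ^ (2 ^ dC - 1) * (((nB : ℝ) + nA) * g) ^ (2 ^ dC)) ?_
  filter_upwards [Filter.eventually_ge_atTop 1] with N hN
  have h : maxGraverNorm (fourBlock N C D B A) ≤
      (2 * K) ^ (2 ^ dC - 1) * ((nB + nA) * g * N) ^ (2 ^ dC) := by
    refine (maxGraverNorm_fourBlock_le N C D B A (by omega) hC hD).trans ?_
    gcongr
    refine (maxGraverNorm_twoStage_le hg N).trans ?_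
    calc (nB + N * nA) * g ≤ (nB * N + N * nA) * g := by
          gcongr
          exact Nat.le_mul_of_pos_right _ hN
      _ = (nB + nA) * g * N := by ring
  rw [Real.norm_of_nonneg (by positivity), Real.norm_of_nonneg (by positivity), mul_assoc,
    ← mul_pow]
  exact_mod_cast h

theorem mainTheorem5 {dA nA nB : ℕ} (A : Matrix (Fin dA) (Fin nA) ℤ)
    (B : Matrix (Fin dA) (Fin nB) ℤ) :
    -- a bound `g` that depends only on `A` and `B` exists
    (∃ g : ℕ, IsTwoStageGraverBound A B g) ∧
    ∀ {dC : ℕ} (C : Matrix (Fin dC) (Fin nB) ℤ) (D : Matrix (Fin dC) (Fin nA) ℤ),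
      -- the Graver bases are finite, so that the maxima below are maxima
      (∀ N : ℕ, (graverBasis (twoStage N B A)).Finite ∧
        (graverBasis (fourBlock N C D B A)).Finite) ∧
      -- the explicit bounds
      (∀ g : ℕ, IsTwoStageGraverBound A B g →
        ∀ M : ℝ, 1 ≤ M → (∀ i j, |(C i j : ℝ)| ≤ M) → (∀ i j, |(D i j : ℝ)| ≤ M) →
        ∀ N : ℕ,
          (maxGraverNorm (fourBlock N C D B A) : ℝ) ≤
              (2 * ((nB : ℝ) + N * nA) * M) ^ (2 ^ dC - 1) *
                (maxGraverNorm (twoStage N B A) : ℝ) ^ (2 ^ dC) ∧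
          (2 * ((nB : ℝ) + N * nA) * M) ^ (2 ^ dC - 1) *
                (maxGraverNorm (twoStage N B A) : ℝ) ^ (2 ^ dC) ≤
              (2 * ((nB : ℝ) + N * nA) * M) ^ (2 ^ dC - 1) *
                (((nB : ℝ) + N * nA) * g) ^ (2 ^ dC)) ∧
      -- the growth rate for fixed blocks
      (fun N : ℕ => (maxGraverNorm (fourBlock N C D B A) : ℝ)) =O[Filter.atTop]
        (fun N : ℕ => (N : ℝ) ^ (2 ^ dC + 1)) := by

  refine ⟨exists_isTwoStageGraverBound A B, fun {dC} C D => ⟨fun N => ⟨finite_graverBasis _,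
    finite_graverBasis _⟩, fun g hg M hM hC hD N =>
    ⟨maxGraverNorm_fourBlock_le_real N C D B A hM hC hD, ?_⟩, ?_⟩⟩
  · gcongr
    exact_mod_cast maxGraverNorm_twoStage_le hg N
  · refine (isBigO_maxGraverNorm_fourBlock C D B A).trans (Asymptotics.IsBigO.of_bound 1 ?_)
    filter_upwards [Filter.eventually_ge_atTop 1] with N hN
    rw [Real.norm_of_nonneg (by positivity), Real.norm_of_nonneg (by positivity), one_mul]
    exact pow_le_pow_right₀ (by exact_mod_cast hN) (Nat.le_succ _)
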